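/- All graphs are finite and simple. A graph $G=(V,E)$ is word-representable if there is a word $w$ over the alphabet $V$, containing each letter of $V$ at least once, such that for all distinct $x,y\in V$: $xy\in E$ if and only if $x$ and $y$ alternate in $w$, i.e. deleting from $w$ all letters other than $x$ and $y$ leaves a word $xyxy\cdots$ or $yxyx\cdots$ (of even or odd length). Write $S_n=(E_{n-m},K_m)$ for a split graph on $n$ vertices whose vertex set is partitioned into an independent set $E_{n-m}$ of size $n-m$ and a maximal clique $K_m$ of size $m$. Let $T_2$ be the graph on $\{1,\dots,7\}$ in which $1,2,3,4$ form a clique and the vertices $5,6,7$ are of degree $2$, with neighbourhoods $\{2,3\}$, $\{2,4\}$, $\{1,2\}$ respectively. For $\ell\ge 4$, let $A_\ell$ be the graph consisting of a complete graph on the vertices $1,\dots,\ell-1$; for each $i\in\{1,\dots,\ell-2\}$ a vertex $i'$ joined exactly to $i$ and $i+1$; a vertex $(\ell-1)'$ joined exactly to $1$ and $\ell-1$; and a vertex $\ell$ joined exactly to $1,\dots,\ell-1$. Theorem. Let $m\ge 1$ and let $S_n=(E_{n-m},K_m)$ be a split graph in which every vertex of $E_{n-m}$ has degree at most $2$. Then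 $S_n$ is word-representable if and only if it contains neither $T_2$ nor any $A_\ell$, $\ell\ge 4$, as an induced subgraph. -/

import Mathlib

/-- The word `x y x y ⋯` of length `k` (beginning with `x` if `k > 0`). -/
def altWord {V : Type*} (x y : V) : ℕ → List V
  | 0 => []
  | k + 1 => x :: altWord y x k

/-- `x` and `y` alternate in `w`: deleting from `w` all letters but the copies of `x` and `y`
leaves a word `x y x y ⋯` or a word `y x y x ⋯` (of even or odd length). -/
def AlternateIn {V : Type*} [DecidableEq V] (w : List V) (x y : V) : Prop :=
  ∃ k : ℕ, w.filter (fun z => z = x ∨ z = y) = altWord x y k ∨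
    w.filter (fun z => z = x ∨ z = y) = altWord y x k

/-- `G` is word-representable: some word over the vertex set, containing every vertex, is such that
distinct vertices alternate in it if and only if they are adjacent. -/
def WordRepresentable {V : Type*} [DecidableEq V] (G : SimpleGraph V) : Prop :=
  ∃ w : List V, (∀ v : V, v ∈ w) ∧
    ∀ x y : V, x ≠ y → (AlternateIn w x y ↔ G.Adj x y)

/-- The vertex set of `G` is partitioned into the independent set `E` and the maximal clique `K`;
that is, `G` is the split graph `(E, K)`. -/
structure IsSplitPartition {V : Type*} (G : SimpleGraph V) (E K : Finset V) : Prop where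
  disjoint : Disjoint E K
  cover : ∀ v : V, v ∈ E ∨ v ∈ K
  indep : G.IsIndepSet (E : Set V)
  clique : Maximal G.IsClique (K : Set V)

/-- The graph `K^△_l` (meant for `l ≥ 3`). The vertices `Sum.inl i` form a complete graph on `l`
vertices, and `Sum.inr i` (the vertex `i'`) is joined exactly to `i` and to its cyclic
successor `i + 1`. -/
def kTriangle (l : ℕ) : SimpleGraph (Fin l ⊕ Fin l) where
  Adj
    | Sum.inl i, Sum.inl j => i ≠ j
    | Sum.inl i, Sum.inr j => i = j ∨ (i : ℕ) = ((j : ℕ) + 1) % l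
    | Sum.inr j, Sum.inl i => i = j ∨ (i : ℕ) = ((j : ℕ) + 1) % l
    | Sum.inr _, Sum.inr _ => False
  symm := ⟨by rintro (i | i) (j | j) h <;> first | exact h.symm | exact h⟩
  loopless := ⟨by rintro (i | i) h <;> simp at h⟩

/-- The graph `A_l` (meant for `l ≥ 4`): `K^△_{l-1}` together with one new vertex `none`,
joined to all vertices of the complete graph `K_{l-1}` and to no other vertices. -/
def graphA (l : ℕ) : SimpleGraph (Option (Fin (l - 1) ⊕ Fin (l - 1))) where
  Adj
    | some a, some b => (kTriangle (l - 1)).Adj a b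
    | none, some (Sum.inl _) => True
    | some (Sum.inl _), none => True
    | _, _ => False
  symm := ⟨by
    rintro (_ | i | i) (_ | j | j) h <;>
      first | exact h | exact SimpleGraph.Adj.symm (G := kTriangle (l - 1)) h⟩
  loopless := ⟨by
    rintro (_ | i | i) h <;> first | exact (kTriangle (l - 1)).loopless.irrefl _ h | exact h⟩

/-- The graph `T_2`: a complete graph on `0, 1, 2, 3`, and three further vertices `4, 5, 6` of
degree two, joined to the pairs `1, 2`, and `1, 3`, and `0, 1` respectively. -/
def graphT2 : SimpleGraph (Fin 7) :=
  SimpleGraph.fromEdgeSet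
    {s(0, 1), s(0, 2), s(0, 3), s(1, 2), s(1, 3), s(2, 3),
     s(4, 1), s(4, 2), s(5, 1), s(5, 3), s(6, 0), s(6, 1)}

/-!
Both directions rest on one reformulation: distinct letters `x`, `y` alternate in a word, starting
with `x`, exactly when in every prefix the count of `y` is at most the count of `x`, which is at
most the count of `y` plus one (`alternateIn_iff_interlaced`).

Necessity. The letter counts of a clique are totally ordered pointwise and any two differ by at
most one. If a vertex `e` is adjacent to two clique vertices `p`, `q`, the inequalities force it to
be adjacent to every clique vertex between them in this order, or to every one beyond them. So the
two clique neighbours of a vertex of degree two are consecutive in a fixed cyclic order of the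
clique (`CountRepresents.exists_rank`). In `graphT2` a vertex of a clique on four vertices would be
consecutive to three others; in `graphA l` a cycle would be laid along the cyclic order of a clique
while omitting the vertex `none`. Both are impossible.

Sufficiency. Join two vertices of `K` when they have a common neighbour in `E`. A vertex with three
neighbours in this graph yields a copy of `graphT2` and a cycle missing a vertex of `K` yields a
copy of some `graphA l`. Without these the graph is a disjoint union of paths or a single cycle
through all of `K`, so `K` can be arranged on a cycle with adjacent vertices consecutive
(`exists_cyclic_position`). Every vertex of `E` then sees an arc of at most two consecutive
positions, and a word is written down (`wordRepresentable_of_position`): it runs twice through `K`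
and a vertex of `E` is placed on both sides of its arc in one of the two runs and once more at the
start or the end of the word, in the reverse order so as to spoil the alternation within `E`. If the
arc wraps around, the vertex is placed just after the first position in the first run and just
before the last position in the second. That all pairs behave as required is a comparison of the
times at which the letters occur.
-/

/-! ### Alternation in terms of counts -/

/-- `f` runs ahead of `g`, but never by more than one. For the counts of two letters in the prefixes
of a word this says that the two letters alternate and that the first of them comes first. -/
def Interlaced (f g : ℕ → ℕ) : Prop :=
  ∀ n, g n ≤ f n ∧ f n ≤ g n + 1

/-- The number of occurrences of `x` among the first `n` letters of `w`. -/
def prefixCount {V : Type*} [DecidableEq V] (w : List V) (x : V) (n : ℕ) : ℕ :=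
  (w.take n).count x

section Counts

variable {V : Type*} [DecidableEq V]

theorem exists_filter_eq_altWord_iff (w : List V) (x y : V) (hxy : x ≠ y) :
    (∃ k, w.filter (fun z => z = x ∨ z = y) = altWord x y k) ↔
      Interlaced (prefixCount w x) (prefixCount w y) := by
  induction w generalizing x y with
  | nil => exact ⟨fun _ n => by simp [prefixCount], fun _ => ⟨0, rfl⟩⟩
  | cons z w ih =>
    have hcons : ∀ v n, prefixCount (z :: w) v (n + 1) =
        prefixCount w v n + if z = v then 1 else 0 := by
      intro v n
      simp [prefixCount, List.count_cons]
    have hzero : ∀ v, prefixCount (z :: w) v 0 = 0 := fun v => by simp [prefixCount]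
    have hsplit : Interlaced (prefixCount (z :: w) x) (prefixCount (z :: w) y) ↔
        ∀ n, prefixCount w y n + (if z = y then 1 else 0) ≤
            prefixCount w x n + (if z = x then 1 else 0) ∧
          prefixCount w x n + (if z = x then 1 else 0) ≤
            prefixCount w y n + (if z = y then 1 else 0) + 1 := by
      constructor
      · intro h n
        simpa only [hcons] using h (n + 1)
      · rintro h (_ | n)
        · simp [hzero]
        · simpa only [hcons] using h n
    rw [hsplit]
    by_cases hzx : z = x
    · subst hzx
      have hswap : w.filter (fun u => u = z ∨ u = y) = w.filter (fun u => u = y ∨ u = z) := by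
        simp only [or_comm]
      have hfilter : (z :: w).filter (fun u => u = z ∨ u = y) =
          z :: w.filter (fun u => u = y ∨ u = z) := by
        rw [← hswap]; simp
      rw [hfilter]
      have hk : (∃ k, z :: w.filter (fun u => u = y ∨ u = z) = altWord z y k) ↔
          ∃ k, w.filter (fun u => u = y ∨ u = z) = altWord y z k := by
        constructor
        · rintro ⟨_ | k, h⟩
          · simp [altWord] at h
          · exact ⟨k, by simpa only [altWord, List.cons.injEq, true_and] using h⟩
        · rintro ⟨k, h⟩
          exact ⟨k + 1, by rw [altWord, h]⟩
      rw [hk, ih y z hxy.symm]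
      simp only [Interlaced, hxy, if_true, if_false]
      exact forall_congr' fun n => by omega
    · by_cases hzy : z = y
      · subst hzy
        constructor
        · rintro ⟨_ | k, h⟩
          · simp [altWord] at h
          · simp only [altWord, or_true, decide_true, List.filter_cons_of_pos,
              List.cons.injEq] at h
            exact absurd h.1 hzx
        · intro h
          have := h 0
          simp [prefixCount, hzx] at this
      · rw [List.filter_cons_of_neg (by simp [hzx, hzy]), ih x y hxy]
        simp [Interlaced, hzx, hzy]

theorem alternateIn_iff_interlaced (w : List V) (x y : V) (hxy : x ≠ y) :
    AlternateIn w x y ↔ Interlaced (prefixCount w x) (prefixCount w y) ∨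
      Interlaced (prefixCount w y) (prefixCount w x) := by
  rw [← exists_filter_eq_altWord_iff w x y hxy, ← exists_filter_eq_altWord_iff w y x hxy.symm,
    AlternateIn, exists_or]
  simp only [or_comm (a := _ = y)]

theorem prefixCount_injective (w : List V) (hw : ∀ v, v ∈ w) :
    Function.Injective (prefixCount w) := by
  intro x y hxy
  obtain ⟨n, hn, rfl⟩ := List.getElem_of_mem (hw x)
  have h0 := congrFun hxy n
  have h1 := congrFun hxy (n + 1)
  by_contra hne
  simp only [prefixCount, List.take_succ_eq_append_getElem hn, List.count_append,
    List.count_singleton_self] at h0 h1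
  rw [List.count_singleton, if_neg (by simpa using hne)] at h1
  omega

end Counts

/-! ### Cliques in word-representable graphs -/

/-- The functions `c x` behave like the letter counts of a word that represents `H`. -/
structure CountRepresents {W : Type*} (H : SimpleGraph W) (c : W → ℕ → ℕ) : Prop where
  injective : Function.Injective c
  adj_iff : ∀ x y, x ≠ y → (H.Adj x y ↔ Interlaced (c x) (c y) ∨ Interlaced (c y) (c x))

theorem WordRepresentable.exists_countRepresents {V W : Type*} [DecidableEq V]
    {G : SimpleGraph V} {H : SimpleGraph W} (hG : WordRepresentable G)
    (hH : H.IsIndContained G) : ∃ c, CountRepresents H c := by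
  obtain ⟨w, hw, hadj⟩ := hG
  obtain ⟨f⟩ := hH
  refine ⟨fun x => prefixCount w (f x), (prefixCount_injective w hw).comp f.injective, ?_⟩
  intro x y hxy
  have hf : f x ≠ f y := f.injective.ne hxy
  rw [← alternateIn_iff_interlaced w _ _ hf, hadj _ _ hf, f.map_adj_iff]

section Clique

variable {W : Type*} {H : SimpleGraph W} {c : W → ℕ → ℕ}

theorem CountRepresents.le_or_le (hc : CountRepresents H c) {S : Finset W}
    (hS : H.IsClique (S : Set W)) {x y : W} (hx : x ∈ S) (hy : y ∈ S) :
    c x ≤ c y ∨ c y ≤ c x := by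
  by_cases hxy : x = y
  · exact Or.inl (hxy ▸ le_rfl)
  · rcases (hc.adj_iff x y hxy).1 (hS hx hy hxy) with h | h
    · exact Or.inr fun n => (h n).1
    · exact Or.inl fun n => (h n).1

theorem CountRepresents.le_add_one (hc : CountRepresents H c) {S : Finset W}
    (hS : H.IsClique (S : Set W)) {x y : W} (hx : x ∈ S) (hy : y ∈ S) (n : ℕ) :
    c x n ≤ c y n + 1 := by
  by_cases hxy : x = y
  · subst hxy; omega
  · rcases (hc.adj_iff x y hxy).1 (hS hx hy hxy) with h | h <;> have := h n <;> omega

/-- A vertex adjacent to `p` and `q` sees every vertex of the clique between them, or every vertex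
of the clique beyond them: if its count runs ahead of both or behind both, then it is interlaced
with everything between, and if it lies between the two, then with everything beyond. -/
theorem CountRepresents.between_or_beyond (hc : CountRepresents H c) {S : Finset W}
    (hS : H.IsClique (S : Set W)) {e p q : W} (hp : p ∈ S) (hq : q ∈ S) (hpq : c q ≤ c p)
    (hne : p ≠ q) (hep : H.Adj e p) (heq : H.Adj e q) :
    (∀ z ∈ S, z ≠ e → ¬ H.Adj e z → ¬ (c q ≤ c z ∧ c z ≤ c p)) ∨
      (∀ z ∈ S, z ≠ e → ¬ H.Adj e z → ¬ (c z ≤ c q ∨ c p ≤ c z)) := by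
  have h1 := (hc.adj_iff e p hep.ne).1 hep
  have h2 := (hc.adj_iff e q heq.ne).1 heq
  have hp' := fun n => hc.le_add_one hS hp hq n
  rcases h1 with h1 | h1 <;> rcases h2 with h2 | h2
  · refine Or.inl fun z hz hze hadj hb => hadj ((hc.adj_iff e z hze.symm).2 (Or.inl fun n => ?_))
    have := h1 n; have := h2 n
    have : c q n ≤ c z n := hb.1 n
    have : c z n ≤ c p n := hb.2 n
    omega
  · -- Here `c q ≤ c p ≤ c e ≤ c q`.
    refine absurd (hc.injective (le_antisymm (fun n => ?_) hpq)) hne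
    have := h1 n; have := h2 n
    change c p n ≤ c q n
    omega
  · refine Or.inr fun z hz hze hadj hb => hadj ((hc.adj_iff e z hze.symm).2 ?_)
    have hz1 := fun n => hc.le_add_one hS hz hq n
    have hz2 := fun n => hc.le_add_one hS hp hz n
    rcases hb with hb | hb
    · refine Or.inl fun n => ?_
      have := h1 n; have := h2 n; have := hz2 n
      have : c z n ≤ c q n := hb n
      omega
    · refine Or.inr fun n => ?_
      have := h1 n; have := h2 n; have := hz1 n
      have : c p n ≤ c z n := hb n
      omega
  · refine Or.inl fun z hz hze hadj hb => hadj ((hc.adj_iff e z hze.symm).2 (Or.inr fun n => ?_))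
    have := h1 n; have := h2 n
    have : c q n ≤ c z n := hb.1 n
    have : c z n ≤ c p n := hb.2 n
    omega

/-- A clique in a word-representable graph has a cyclic order, given by a rank function, in which
the two clique neighbours `p`, `q` of an outside vertex are consecutive: its non-neighbours in the
clique do not meet both of the open arcs between `p` and `q`. -/
theorem CountRepresents.exists_rank (hc : CountRepresents H c) {S : Finset W}
    (hS : H.IsClique (S : Set W)) :
    ∃ rank : W → ℕ, Set.InjOn rank S ∧ (∀ x, rank x ≤ S.card) ∧
      ∀ e p q, p ∈ S → q ∈ S → p ≠ q → H.Adj e p → H.Adj e q →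
        ∀ y z, y ∈ S → z ∈ S → y ≠ e → z ≠ e → ¬ H.Adj e y → ¬ H.Adj e z →
          (rank p < rank y ∧ rank y < rank q ∨ rank q < rank y ∧ rank y < rank p) →
            (rank p < rank z ∧ rank z < rank q ∨ rank q < rank z ∧ rank z < rank p) := by
  classical
  let rank : W → ℕ := fun x => (S.filter fun z => c z ≤ c x).card
  have hrank : ∀ x ∈ S, ∀ y ∈ S, rank x ≤ rank y → c x ≤ c y := by
    intro x hx y hy hle
    by_contra hxy
    have hyx : c y ≤ c x := (hc.le_or_le hS hx hy).resolve_left hxy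
    refine absurd (Finset.card_lt_card (s := S.filter fun z => c z ≤ c y)
      (t := S.filter fun z => c z ≤ c x) ?_) (not_lt.2 hle)
    refine Finset.ssubset_iff_subset_ne.2
      ⟨Finset.monotone_filter_right _ fun z _ hz => le_trans hz hyx, fun h => hxy ?_⟩
    have : x ∈ S.filter fun z => c z ≤ c y := h ▸ Finset.mem_filter.2 ⟨hx, le_rfl⟩
    exact (Finset.mem_filter.1 this).2
  have hinj : Set.InjOn rank S := fun x hx y hy h =>
    hc.injective (le_antisymm (hrank x hx y hy h.le) (hrank y hy x hx h.ge))
  refine ⟨rank, hinj, fun x => Finset.card_filter_le _ _, ?_⟩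
  have key : ∀ e p q, p ∈ S → q ∈ S → p ≠ q → H.Adj e p → H.Adj e q → rank q ≤ rank p →
      ∀ y z, y ∈ S → z ∈ S → y ≠ e → z ≠ e → ¬ H.Adj e y → ¬ H.Adj e z →
        rank q < rank y ∧ rank y < rank p → rank q < rank z ∧ rank z < rank p := by
    intro e p q hp hq hne hep heq hle y z hy hz hye hze hey hez hb
    rcases hc.between_or_beyond hS hp hq (hrank q hq p hp hle) hne hep heq with h | h
    · exact absurd ⟨hrank q hq y hy hb.1.le, hrank y hy p hp hb.2.le⟩ (h y hy hye hey)
    · have h' := h z hz hze hez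
      by_contra hcon
      rcases le_or_gt (rank z) (rank q) with h1 | h1
      · exact h' (Or.inl (hrank z hz q hq h1))
      · exact h' (Or.inr (hrank p hp z hz (by omega)))
  intro e p q hp hq hne hep heq y z hy hz hye hze hey hez hb
  rcases le_total (rank q) (rank p) with hle | hle
  · exact Or.inr (key e p q hp hq hne hep heq hle y z hy hz hye hze hey hez (by omega))
  · exact Or.inl (key e q p hq hp hne.symm heq hep hle y z hy hz hye hze hey hez (by omega))

end Clique

/-! ### The two forbidden induced subgraphs -/

theorem not_countRepresents_graphT2 (c : Fin 7 → ℕ → ℕ) : ¬ CountRepresents graphT2 c := by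
  intro hc
  have hS : graphT2.IsClique (({0, 1, 2, 3} : Finset (Fin 7)) : Set (Fin 7)) := by
    intro x hx y hy hxy
    simp only [Finset.coe_insert, Finset.coe_singleton, Set.mem_insert_iff,
      Set.mem_singleton_iff] at hx hy
    rcases hx with rfl | rfl | rfl | rfl <;> rcases hy with rfl | rfl | rfl | rfl <;>
      simp [graphT2] at hxy ⊢
  obtain ⟨rank, hinj, -, hrank⟩ := hc.exists_rank hS
  have h01 : rank 0 ≠ rank 1 := hinj.ne (by simp) (by simp) (by decide)
  have h02 : rank 0 ≠ rank 2 := hinj.ne (by simp) (by simp) (by decide)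
  have h03 : rank 0 ≠ rank 3 := hinj.ne (by simp) (by simp) (by decide)
  have h12 : rank 1 ≠ rank 2 := hinj.ne (by simp) (by simp) (by decide)
  have h13 : rank 1 ≠ rank 3 := hinj.ne (by simp) (by simp) (by decide)
  have h23 : rank 2 ≠ rank 3 := hinj.ne (by simp) (by simp) (by decide)
  have a1 := hrank 4 1 2 (by simp) (by simp) (by decide) (by simp [graphT2]) (by simp [graphT2])
    0 3 (by simp) (by simp) (by decide) (by decide) (by simp [graphT2]) (by simp [graphT2])
  have a2 := hrank 4 1 2 (by simp) (by simp) (by decide) (by simp [graphT2]) (by simp [graphT2])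
    3 0 (by simp) (by simp) (by decide) (by decide) (by simp [graphT2]) (by simp [graphT2])
  have b1 := hrank 5 1 3 (by simp) (by simp) (by decide) (by simp [graphT2]) (by simp [graphT2])
    0 2 (by simp) (by simp) (by decide) (by decide) (by simp [graphT2]) (by simp [graphT2])
  have b2 := hrank 5 1 3 (by simp) (by simp) (by decide) (by simp [graphT2]) (by simp [graphT2])
    2 0 (by simp) (by simp) (by decide) (by decide) (by simp [graphT2]) (by simp [graphT2])
  have c1 := hrank 6 0 1 (by simp) (by simp) (by decide) (by simp [graphT2]) (by simp [graphT2])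
    2 3 (by simp) (by simp) (by decide) (by decide) (by simp [graphT2]) (by simp [graphT2])
  have c2 := hrank 6 0 1 (by simp) (by simp) (by decide) (by simp [graphT2]) (by simp [graphT2])
    3 2 (by simp) (by simp) (by decide) (by decide) (by simp [graphT2]) (by simp [graphT2])
  clear hrank hinj hS hc
  grind

theorem Nat.succ_mod_eq_ite {i r : ℕ} (h : i < r) :
    (i + 1) % r = if i + 1 = r then 0 else i + 1 := by
  split_ifs with h1
  · rw [h1, Nat.mod_self]
  · exact Nat.mod_eq_of_lt (by omega)

/-- Cutting the cyclic order of the clique at the vertex `none` leaves a linear order in which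
cyclic neighbours `i`, `i + 1` are consecutive. The least element would then have the same vertex
as its successor and its predecessor in the cycle. -/
theorem not_countRepresents_graphA {l : ℕ} (hl : 4 ≤ l)
    (c : Option (Fin (l - 1) ⊕ Fin (l - 1)) → ℕ → ℕ) : ¬ CountRepresents (graphA l) c := by
  classical
  intro hc
  obtain ⟨r, rfl⟩ : ∃ r, l = r + 1 := ⟨l - 1, by omega⟩
  simp only [Nat.add_sub_cancel] at c hc
  have hr : 3 ≤ r := by omega
  let v : Fin r → Option (Fin r ⊕ Fin r) := fun i => some (Sum.inl i)
  let S : Finset (Option (Fin r ⊕ Fin r)) := insert none (Finset.univ.image v)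
  have hvS : ∀ i, v i ∈ S := fun i => by simp [S]
  have hnS : none ∈ S := by simp [S]
  have hS : (graphA (r + 1)).IsClique (S : Set (Option (Fin r ⊕ Fin r))) := by
    intro x hx y hy hxy
    simp only [S, Finset.coe_insert, Finset.coe_image, Finset.coe_univ, Set.image_univ,
      Set.mem_insert_iff, Set.mem_range] at hx hy
    rcases hx with rfl | ⟨i, rfl⟩ <;> rcases hy with rfl | ⟨j, rfl⟩
    · exact absurd rfl hxy
    · trivial
    · trivial
    · change i ≠ j
      rintro rfl
      exact hxy rfl
  obtain ⟨rank, hinj, hcard, hrank⟩ := hc.exists_rank hS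
  have hadj : ∀ i j : Fin r, (graphA (r + 1)).Adj (some (Sum.inr j)) (v i) ↔
      (i = j ∨ (i : ℕ) = ((j : ℕ) + 1) % r) := fun i j => Iff.rfl
  have hadjn : ∀ j : Fin r, ¬ (graphA (r + 1)).Adj (some (Sum.inr j)) none := fun j h => h
  have hvinj : ∀ i j, i ≠ j → rank (v i) ≠ rank (v j) := fun i j hij =>
    hinj.ne (hvS i) (hvS j) (by simpa [v] using hij)
  have hvn : ∀ i, rank (v i) ≠ rank none := fun i => hinj.ne (hvS i) hnS (by simp [v])
  let key : Fin r → ℕ := fun i =>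
    if rank none < rank (v i) then rank (v i) else rank (v i) + S.card + 1
  obtain ⟨i, -, hi⟩ := Finset.exists_min_image Finset.univ key ⟨⟨0, by omega⟩, Finset.mem_univ _⟩
  obtain ⟨j, hj⟩ : ∃ j : Fin r, (j : ℕ) = ((i : ℕ) + 1) % r :=
    ⟨⟨((i : ℕ) + 1) % r, Nat.mod_lt _ (by omega)⟩, rfl⟩
  obtain ⟨k, hk⟩ : ∃ k : Fin r, (i : ℕ) = ((k : ℕ) + 1) % r := by
    by_cases h0 : (i : ℕ) = 0
    · refine ⟨⟨r - 1, by omega⟩, ?_⟩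
      rw [Nat.succ_mod_eq_ite (by simp; omega), if_pos (by simp; omega), h0]
    · refine ⟨⟨i - 1, by omega⟩, ?_⟩
      have := i.2
      rw [Nat.succ_mod_eq_ite (by simp; omega), if_neg (by simp; omega)]
      simp; omega
  have hj' := hj
  have hk' := hk
  rw [Nat.succ_mod_eq_ite i.2] at hj'
  rw [Nat.succ_mod_eq_ite k.2] at hk'
  have hi2 := i.2
  have hk2 := k.2
  have hij : i ≠ j := fun h => by subst h; split_ifs at hj' <;> omega
  have hik : i ≠ k := fun h => by subst h; split_ifs at hk' <;> omega
  have hjk : j ≠ k := fun h => by subst h; split_ifs at hj' hk' <;> omega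
  have hki : ¬ (graphA (r + 1)).Adj (some (Sum.inr i)) (v k) := by
    rw [hadj]
    rintro (h | h)
    · exact hik h.symm
    · exact hjk (Fin.ext (hj.trans h.symm))
  have hjk' : ¬ (graphA (r + 1)).Adj (some (Sum.inr k)) (v j) := by
    rw [hadj]
    rintro (h | h)
    · exact hjk h
    · exact hij (Fin.ext (hk.trans h.symm))
  have hvne : ∀ a b : Fin r, v a ≠ some (Sum.inr b) := fun a b => by simp [v]
  have hne : ∀ a b : Fin r, a ≠ b → v a ≠ v b := fun a b h => by simpa [v] using h
  have a1 := hrank (some (Sum.inr i)) (v i) (v j) (hvS i) (hvS j) (hne _ _ hij)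
    ((hadj _ _).2 (Or.inl rfl)) ((hadj _ _).2 (Or.inr hj)) (v k) none (hvS k) hnS (hvne _ _)
    (by simp) hki (hadjn i)
  have a2 := hrank (some (Sum.inr i)) (v i) (v j) (hvS i) (hvS j) (hne _ _ hij)
    ((hadj _ _).2 (Or.inl rfl)) ((hadj _ _).2 (Or.inr hj)) none (v k) hnS (hvS k)
    (by simp) (hvne _ _) (hadjn i) hki
  have b1 := hrank (some (Sum.inr k)) (v i) (v k) (hvS i) (hvS k) (hne _ _ hik)
    ((hadj _ _).2 (Or.inr hk)) ((hadj _ _).2 (Or.inl rfl)) (v j) none (hvS j) hnS (hvne _ _)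
    (by simp) hjk' (hadjn k)
  have b2 := hrank (some (Sum.inr k)) (v i) (v k) (hvS i) (hvS k) (hne _ _ hik)
    ((hadj _ _).2 (Or.inr hk)) ((hadj _ _).2 (Or.inl rfl)) none (v j) hnS (hvS j)
    (by simp) (hvne _ _) (hadjn k) hjk'
  have k1 := hi j (Finset.mem_univ _)
  have k2 := hi k (Finset.mem_univ _)
  have n1 := hvn i
  have n2 := hvn j
  have n3 := hvn k
  have m1 := hvinj i j hij
  have m2 := hvinj i k hik
  have m3 := hvinj j k hjk
  have l1 := hcard (v i)
  have l2 := hcard (v j)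
  have l3 := hcard (v k)
  have l4 := hcard none
  simp only [key] at k1 k2
  clear hrank hi hinj hcard hvn hvinj hj hk hj' hk'
  split_ifs at k1 k2 <;> omega

/-! ### Graphs of maximum degree two -/

section Ordering

variable {V : Type*} {H : SimpleGraph V}

/-- The vertices of a path, in order. -/
structure IsPathList (H : SimpleGraph V) (l : List V) : Prop where
  nodup : l.Nodup
  adj : ∀ i (h : i + 1 < l.length), H.Adj l[i] l[i + 1]

theorem IsPathList.cons {l : List V} (hl : IsPathList H l) (hpos : 0 < l.length) {y : V}
    (hy : y ∉ l) (hadj : H.Adj l[0] y) : IsPathList H (y :: l) where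
  nodup := List.nodup_cons.2 ⟨hy, hl.nodup⟩
  adj := by
    rintro (_ | i) h
    · simpa using hadj.symm
    · simpa using hl.adj i (by simpa using h)

theorem IsPathList.append_singleton {l : List V} (hl : IsPathList H l) {i : ℕ}
    (hi : i < l.length) (hlast : i + 1 = l.length) {y : V}
    (hy : y ∉ l) (hadj : H.Adj l[i] y) : IsPathList H (l ++ [y]) where
  nodup := by
    rw [List.nodup_append]
    refine ⟨hl.nodup, List.nodup_singleton y, fun a ha b hb => ?_⟩
    rw [List.mem_singleton.1 hb]
    rintro rfl
    exact hy ha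
  adj := by
    intro j h
    simp only [List.length_append, List.length_singleton] at h
    by_cases hj : j + 1 < l.length
    · simpa [List.getElem_append, hj, Nat.lt_of_succ_lt hj] using hl.adj j hj
    · obtain rfl : j = i := by omega
      simpa [List.getElem_append, hi, hj] using hadj

theorem IsPathList.eq_or_eq_of_adj
    (hdeg : ∀ x a b c, H.Adj x a → H.Adj x b → H.Adj x c → a = b ∨ a = c ∨ b = c)
    {l : List V} (hl : IsPathList H l) {i : ℕ} (hi : i + 2 < l.length) {y : V}
    (hy : H.Adj l[i + 1] y) : y = l[i] ∨ y = l[i + 2] := by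
  rcases hdeg _ _ _ _ (hl.adj i (by omega)).symm (hl.adj (i + 1) (by omega)) hy with h | h | h
  · rw [hl.nodup.getElem_inj_iff] at h
    omega
  · exact Or.inl h.symm
  · exact Or.inr h.symm

/-- The vertices of a cycle, in order. -/
structure IsCycleList (H : SimpleGraph V) (l : List V) : Prop extends IsPathList H l where
  three_le : 3 ≤ l.length
  adj_last : H.Adj l[l.length - 1] l[0]

/-- In a graph of maximum degree two without cycles, two vertices of a path are adjacent only if
they are consecutive on it. -/
theorem IsPathList.eq_succ_of_adj
    (hdeg : ∀ x a b c, H.Adj x a → H.Adj x b → H.Adj x c → a = b ∨ a = c ∨ b = c)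
    {l : List V} (hl : IsPathList H l) (hcyc : ¬ IsCycleList H l) {i j : ℕ} (hij : i < j)
    (hj : j < l.length) (hadj : H.Adj l[i] l[j]) : j = i + 1 := by
  rcases i with _ | i
  · by_cases hj' : j + 1 < l.length
    · obtain ⟨j, rfl⟩ : ∃ k, j = k + 1 := ⟨j - 1, by omega⟩
      rcases hl.eq_or_eq_of_adj hdeg hj' hadj.symm with h | h <;>
        rw [hl.nodup.getElem_inj_iff] at h <;> omega
    · by_contra hne
      obtain rfl : j = l.length - 1 := by omega
      exact hcyc ⟨hl, by omega, hadj.symm⟩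
  · rcases hl.eq_or_eq_of_adj hdeg (by omega) hadj with h | h <;>
      rw [hl.nodup.getElem_inj_iff] at h <;> omega

theorem exists_longest_pathList (S : Finset V) (hS : S.Nonempty) :
    ∃ l, IsPathList H l ∧ l ≠ [] ∧ (∀ x ∈ l, x ∈ S) ∧
      ∀ l', IsPathList H l' → (∀ x ∈ l', x ∈ S) → l'.length ≤ l.length := by
  classical
  let P : ℕ → Prop := fun n => ∃ l, IsPathList H l ∧ (∀ x ∈ l, x ∈ S) ∧ l.length = n
  have hbound : ∀ l, IsPathList H l → (∀ x ∈ l, x ∈ S) → l.length ≤ S.card := by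
    intro l hl hlS
    rw [← List.toFinset_card_of_nodup hl.nodup]
    exact Finset.card_le_card fun x hx => hlS x (List.mem_toFinset.1 hx)
  obtain ⟨x, hx⟩ := hS
  have hx1 : P 1 := ⟨[x], ⟨List.nodup_singleton x, fun i h => by simp at h⟩, by simpa using hx, rfl⟩
  have hcard : 1 ≤ S.card := Finset.card_pos.2 ⟨x, hx⟩
  obtain ⟨l, hl, hlS, hlen⟩ := Nat.findGreatest_spec hcard hx1
  have hmax : ∀ l', IsPathList H l' → (∀ x ∈ l', x ∈ S) → l'.length ≤ l.length :=
    fun l' hl' hlS' => hlen ▸ Nat.le_findGreatest (hbound l' hl' hlS') ⟨l', hl', hlS', rfl⟩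
  refine ⟨l, hl, ?_, hlS, hmax⟩
  rintro rfl
  obtain ⟨l', hl', hlS', hlen'⟩ := hx1
  have := hmax l' hl' hlS'
  simp only [List.length_nil] at this
  omega

/-- A longest path in a set closed under adjacency is closed under adjacency. -/
theorem IsPathList.mem_of_adj
    (hdeg : ∀ x a b c, H.Adj x a → H.Adj x b → H.Adj x c → a = b ∨ a = c ∨ b = c)
    {S : Finset V} (hclosed : ∀ x ∈ S, ∀ y, H.Adj x y → y ∈ S) {l : List V}
    (hl : IsPathList H l) (hlS : ∀ x ∈ l, x ∈ S)
    (hmax : ∀ l', IsPathList H l' → (∀ x ∈ l', x ∈ S) → l'.length ≤ l.length) {x y : V}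
    (hx : x ∈ l) (hxy : H.Adj x y) : y ∈ l := by
  by_contra hy
  have hyS : y ∈ S := hclosed x (hlS x hx) y hxy
  obtain ⟨i, hi, rfl⟩ := List.getElem_of_mem hx
  by_cases hlast : i + 1 = l.length
  · have := hmax _ (hl.append_singleton hi hlast hy hxy) (by
      simp only [List.mem_append, List.mem_singleton]
      rintro z (hz | rfl)
      exacts [hlS z hz, hyS])
    simp at this
  · rcases i with _ | i
    · have := hmax _ (hl.cons hi hy hxy) (by
        simp only [List.mem_cons]
        rintro z (rfl | hz)
        exacts [hyS, hlS z hz])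
      simp at this
    · rcases hl.eq_or_eq_of_adj hdeg (by omega) hxy with rfl | rfl <;>
        exact hy (List.getElem_mem _)

/-- The vertices of a graph of maximum degree two without cycles can be listed so that adjacent
vertices are consecutive: a longest path is a union of components, and can be split off. -/
theorem exists_linear_position
    (hdeg : ∀ x a b c, H.Adj x a → H.Adj x b → H.Adj x c → a = b ∨ a = c ∨ b = c)
    (hcyc : ∀ l, ¬ IsCycleList H l) (S : Finset V)
    (hclosed : ∀ x ∈ S, ∀ y, H.Adj x y → y ∈ S) :
    ∃ pos : V → ℕ, Set.InjOn pos S ∧ (∀ x ∈ S, pos x < S.card) ∧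
      ∀ x ∈ S, ∀ y ∈ S, H.Adj x y → pos x = pos y + 1 ∨ pos y = pos x + 1 := by
  classical
  induction S using Finset.strongInduction with
  | H S ih =>
    rcases S.eq_empty_or_nonempty with rfl | hS
    · exact ⟨fun _ => 0, by simp, by simp, by simp⟩
    obtain ⟨l, hl, hne, hlS, hmax⟩ := exists_longest_pathList (H := H) S hS
    have hmem : ∀ x y, x ∈ l → H.Adj x y → y ∈ l := fun x y hx hxy =>
      hl.mem_of_adj hdeg hclosed hlS hmax hx hxy
    have hsub : l.toFinset ⊆ S := fun x hx => hlS x (List.mem_toFinset.1 hx)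
    have hlen : 0 < l.length := List.length_pos_iff.2 hne
    have hcard := Finset.card_sdiff_add_card_eq_card hsub
    rw [List.toFinset_card_of_nodup hl.nodup] at hcard
    have hssub : S \ l.toFinset ⊂ S := by
      refine Finset.ssubset_iff_subset_ne.2 ⟨Finset.sdiff_subset, fun h => ?_⟩
      rw [h] at hcard
      omega
    obtain ⟨pos, hinj, hlt, hpos⟩ := ih _ hssub (by
      intro x hx y hxy
      simp only [Finset.mem_sdiff, List.mem_toFinset] at hx ⊢
      exact ⟨hclosed x hx.1 y hxy, fun hy => hx.2 (hmem y x hy hxy.symm)⟩)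
    have hrest : ∀ x ∈ S, x ∉ l → x ∈ S \ l.toFinset := fun x hx hxl => by simp [hx, hxl]
    refine ⟨fun x => if x ∈ l then l.idxOf x else l.length + pos x, ?_, ?_, ?_⟩
    · intro x hx y hy hxy
      simp only at hxy
      split_ifs at hxy with h1 h2 h2
      · exact (List.idxOf_inj h1).1 hxy
      · have := List.idxOf_lt_length_iff.2 h1
        omega
      · have := List.idxOf_lt_length_iff.2 h2
        omega
      · exact hinj (hrest x hx h1) (hrest y hy h2) (by omega)
    · intro x hx
      simp only
      split_ifs with h1
      · have := List.idxOf_lt_length_iff.2 h1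
        omega
      · have := hlt x (hrest x hx h1)
        omega
    · intro x hx y hy hxy
      by_cases h1 : x ∈ l
      · have h2 := hmem x y h1 hxy
        simp only [h1, h2, if_true]
        have hx' := List.idxOf_lt_length_iff.2 h1
        have hy' := List.idxOf_lt_length_iff.2 h2
        have hne' : l.idxOf x ≠ l.idxOf y := fun h => hxy.ne ((List.idxOf_inj h1).1 h)
        have hadj : H.Adj l[l.idxOf x] l[l.idxOf y] := by
          rwa [List.getElem_idxOf, List.getElem_idxOf]
        rcases lt_or_gt_of_ne hne' with h | h
        · exact Or.inr (hl.eq_succ_of_adj hdeg (hcyc l) h hy' hadj)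
        · exact Or.inl (hl.eq_succ_of_adj hdeg (hcyc l) h hx' hadj.symm)
      · have h2 : y ∉ l := fun h2 => h1 (hmem y x h2 hxy.symm)
        simp only [h1, h2, if_false]
        have := hpos x (hrest x hx h1) y (hrest y hy h2) hxy
        omega

theorem IsCycleList.idxOf_of_adj [DecidableEq V]
    (hdeg : ∀ x a b c, H.Adj x a → H.Adj x b → H.Adj x c → a = b ∨ a = c ∨ b = c)
    {l : List V} (hl : IsCycleList H l) {x y : V} (hx : x ∈ l) (hy : y ∈ l) (hxy : H.Adj x y) :
    l.idxOf x = l.idxOf y + 1 ∨ l.idxOf y = l.idxOf x + 1 ∨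
      l.idxOf x = 0 ∧ l.idxOf y + 1 = l.length ∨ l.idxOf y = 0 ∧ l.idxOf x + 1 = l.length := by
  have h3 := hl.three_le
  obtain ⟨i, hi, rfl⟩ := List.getElem_of_mem hx
  obtain ⟨j, hj, rfl⟩ := List.getElem_of_mem hy
  rw [hl.nodup.idxOf_getElem, hl.nodup.idxOf_getElem]
  rcases i with _ | i
  · rcases hdeg _ _ _ _ (hl.adj 0 (by omega)) hl.adj_last.symm hxy with h | h | h <;>
      rw [hl.nodup.getElem_inj_iff] at h <;> omega
  · by_cases hlast : i + 2 = l.length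
    · have hadj := hl.adj_last
      simp only [show l.length - 1 = i + 1 by omega] at hadj
      rcases hdeg _ _ _ _ (hl.adj i hi).symm hadj hxy with h | h | h <;>
        rw [hl.nodup.getElem_inj_iff] at h <;> omega
    · rcases hl.eq_or_eq_of_adj hdeg (by omega) hxy with h | h <;>
        rw [hl.nodup.getElem_inj_iff] at h <;> omega

/-- If a graph of maximum degree two on `S` has no cycle that misses a vertex of `S`, then `S` can
be arranged on a cycle so that adjacent vertices are consecutive. -/
theorem exists_cyclic_position
    (hdeg : ∀ x a b c, H.Adj x a → H.Adj x b → H.Adj x c → a = b ∨ a = c ∨ b = c) (S : Finset V)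
    (hclosed : ∀ x y, H.Adj x y → x ∈ S) (hcyc : ∀ l, IsCycleList H l → ∀ x ∈ S, x ∈ l) :
    ∃ pos : V → ℕ, Set.InjOn pos S ∧ (∀ x ∈ S, pos x < S.card) ∧
      ∀ x y, H.Adj x y → pos x = pos y + 1 ∨ pos y = pos x + 1 ∨
        pos x = 0 ∧ pos y + 1 = S.card ∨ pos y = 0 ∧ pos x + 1 = S.card := by
  classical
  by_cases h : ∃ l, IsCycleList H l
  · obtain ⟨l, hl⟩ := h
    have hmem := hcyc l hl
    have hlS : ∀ x ∈ l, x ∈ S := by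
      intro x hx
      obtain ⟨i, hi, rfl⟩ := List.getElem_of_mem hx
      by_cases hlast : i + 1 < l.length
      · exact hclosed _ _ (hl.adj i hlast)
      · obtain rfl : i = l.length - 1 := by omega
        exact hclosed _ _ hl.adj_last
    have hcard : S.card = l.length := by
      rw [← List.toFinset_card_of_nodup hl.nodup]
      congr 1
      ext x
      rw [List.mem_toFinset]
      exact ⟨hmem x, hlS x⟩
    refine ⟨fun x => l.idxOf x, fun x hx y _ hxy => (List.idxOf_inj (hmem x hx)).1 hxy,
      fun x hx => hcard ▸ List.idxOf_lt_length_iff.2 (hmem x hx), fun x y hxy => ?_⟩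
    rw [hcard]
    exact hl.idxOf_of_adj hdeg (hmem x (hclosed x y hxy)) (hmem y (hclosed y x hxy.symm)) hxy
  · obtain ⟨pos, hinj, hlt, hpos⟩ := exists_linear_position hdeg (fun l hl => h ⟨l, hl⟩) S
      fun x _ y hxy => hclosed y x hxy.symm
    refine ⟨pos, hinj, hlt, fun x y hxy => ?_⟩
    rcases hpos x (hclosed x y hxy) y (hclosed y x hxy.symm) hxy with h | h <;> simp [h]

end Ordering

/-! ### Words from occurrence times -/

/-- The number of elements of `l` below `n`. -/
def timeCount (l : List ℕ) (n : ℕ) : ℕ :=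
  l.countP (· < n)

/-- Two letters that occur at the times listed in `l` and in `l'` alternate. -/
def Alternating (l l' : List ℕ) : Prop :=
  Interlaced (timeCount l) (timeCount l') ∨ Interlaced (timeCount l') (timeCount l)

theorem Alternating.symm {l l' : List ℕ} (h : Alternating l l') : Alternating l' l :=
  Or.symm h

theorem alternating_comm {l l' : List ℕ} : Alternating l l' ↔ Alternating l' l :=
  Or.comm

theorem timeCount_succ (l : List ℕ) (n : ℕ) : timeCount l (n + 1) = timeCount l n + l.count n := by
  induction l with
  | nil => rfl
  | cons t l ih =>
    simp only [timeCount, List.countP_cons, List.count_cons, decide_eq_true_eq,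
      beq_iff_eq] at ih ⊢
    rw [ih]
    split_ifs <;> omega

theorem timeCount_mono (l : List ℕ) : Monotone (timeCount l) :=
  monotone_nat_of_le_succ fun n => by rw [timeCount_succ]; omega

theorem timeCount_eq_of_forall (l : List ℕ) {m n : ℕ} (hmn : m ≤ n) (h : ∀ t ∈ l, t < m ∨ n ≤ t) :
    timeCount l m = timeCount l n := by
  refine List.countP_congr fun t ht => ?_
  have := h t ht
  simp only [decide_eq_true_eq]
  omega

/-- Two letters do not alternate if one of them occurs twice with no occurrence of the other in
between. -/
theorem not_alternating_of_lt {l l' : List ℕ} {s t : ℕ} (hs : s ∈ l) (ht : t ∈ l) (hst : s < t)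
    (h : ∀ u ∈ l', u < s ∨ t < u) : ¬ Alternating l l' := by
  have h1 : timeCount l' s = timeCount l' (t + 1) :=
    timeCount_eq_of_forall l' (by omega) fun u hu => by have := h u hu; omega
  have h2 := timeCount_succ l s
  have h3 := timeCount_succ l t
  have h4 : timeCount l (s + 1) ≤ timeCount l t := timeCount_mono l hst
  have h5 := List.count_pos_iff.2 hs
  have h6 := List.count_pos_iff.2 ht
  rintro (h | h)
  · have := h s; have := h (t + 1); omega
  · have := h s; have := h (t + 1); omega

section Realize

variable {V : Type*} [DecidableEq V]

theorem count_filterMap_range {letter : ℕ → Option V} {T : V → List ℕ}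
    (hletter : ∀ n v, letter n = some v ↔ n ∈ T v) (hnodup : ∀ v, (T v).Nodup) (v : V) (N : ℕ) :
    ((List.range N).filterMap letter).count v = timeCount (T v) N := by
  induction N with
  | zero => simp [timeCount]
  | succ N ih =>
    rw [List.range_succ, List.filterMap_append, List.count_append, ih, timeCount_succ]
    congr 1
    by_cases hN : N ∈ T v
    · rw [List.count_eq_one_of_mem (hnodup v) hN]
      simp [(hletter N v).2 hN]
    · rw [List.count_eq_zero_of_not_mem hN]
      cases hl : letter N with
      | none => simp [hl]
      | some u =>
        have : u ≠ v := by
          rintro rfl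
          exact hN ((hletter N u).1 hl)
        simp [hl, this]

theorem exists_take_filterMap_range {α : Type*} (letter : ℕ → Option α) (N n : ℕ) :
    ∃ k, ((List.range N).filterMap letter).take n = (List.range k).filterMap letter := by
  induction N with
  | zero => exact ⟨0, by simp⟩
  | succ N ih =>
    by_cases hn : n ≤ ((List.range N).filterMap letter).length
    · obtain ⟨k, hk⟩ := ih
      exact ⟨k, by
        rw [List.range_succ, List.filterMap_append, List.take_append_of_le_length hn, hk]⟩
    · refine ⟨N + 1, List.take_of_length_le ?_⟩
      have : (List.filterMap letter [N]).length ≤ 1 := List.length_filterMap_le _ _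
      rw [List.range_succ, List.filterMap_append, List.length_append]
      omega

/-- A word may be prescribed by the times at which each letter occurs. -/
theorem wordRepresentable_of_times [Fintype V] (G : SimpleGraph V) (T : V → List ℕ)
    (hne : ∀ v, T v ≠ []) (hnodup : ∀ v, (T v).Nodup)
    (hdisj : ∀ x y t, t ∈ T x → t ∈ T y → x = y)
    (hadj : ∀ x y, x ≠ y → (G.Adj x y ↔ Alternating (T x) (T y))) : WordRepresentable G := by
  classical
  let letter : ℕ → Option V := fun n => if h : ∃ v, n ∈ T v then some h.choose else none
  have hletter : ∀ n v, letter n = some v ↔ n ∈ T v := by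
    intro n v
    by_cases h : ∃ v, n ∈ T v
    · simp only [letter, dif_pos h, Option.some.injEq]
      exact ⟨fun hv => hv ▸ h.choose_spec, fun hv => hdisj _ _ n h.choose_spec hv⟩
    · simp only [letter, dif_neg h, reduceCtorEq, false_iff]
      exact fun hv => h ⟨v, hv⟩
  obtain ⟨N, hN⟩ := Finset.exists_nat_subset_range (Finset.univ.biUnion fun v => (T v).toFinset)
  have hlt : ∀ v, ∀ t ∈ T v, t < N := fun v t ht =>
    Finset.mem_range.1 (hN (Finset.mem_biUnion.2 ⟨v, Finset.mem_univ v, List.mem_toFinset.2 ht⟩))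
  let word : ℕ → List V := fun k => (List.range k).filterMap letter
  have hcount : ∀ v k, (word k).count v = timeCount (T v) k := fun v k =>
    count_filterMap_range hletter hnodup v k
  have hinter : ∀ x y, Interlaced (prefixCount (word N) x) (prefixCount (word N) y) ↔
      Interlaced (timeCount (T x)) (timeCount (T y)) := by
    intro x y
    constructor
    · intro h k
      have hk : ∀ v, prefixCount (word N) v (word (min k N)).length = timeCount (T v) k := by
        intro v
        have htake : (word N).take (word (min k N)).length = word (min k N) := by
          obtain ⟨d, hd⟩ := Nat.exists_eq_add_of_le (min_le_right k N)
          have : word N = word (min k N) ++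
              ((List.range d).map (min k N + ·)).filterMap letter := by
            simp only [word]
            rw [← List.filterMap_append, ← List.range_add, ← hd]
          rw [this, List.take_left]
        rw [prefixCount, htake, hcount]
        refine timeCount_eq_of_forall _ (min_le_left _ _) fun t ht => ?_
        have := hlt v t ht
        omega
      have := h (word (min k N)).length
      rwa [hk x, hk y] at this
    · intro h n
      obtain ⟨k, hk⟩ := exists_take_filterMap_range letter N n
      have hk' : (word N).take n = word k := hk
      simpa only [prefixCount, hk', hcount] using h k
  refine ⟨word N, fun v => ?_, fun x y hxy => ?_⟩
  · obtain ⟨t, ht⟩ := List.exists_mem_of_ne_nil _ (hne v)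
    exact List.mem_filterMap.2 ⟨t, List.mem_range.2 (hlt v t ht), (hletter t v).2 ht⟩
  · rw [alternateIn_iff_interlaced _ _ _ hxy, hinter, hinter, hadj x y hxy, Alternating]

end Realize

/-! ### The word of a cyclic arrangement -/

/-- The time in slot `s` with offset `u`; for offsets up to `3 * r` the times are ordered
lexicographically. -/
def stamp (r s u : ℕ) : ℕ :=
  (3 * r + 1) * s + u

theorem stamp_lt_stamp {r s u s' u' : ℕ} (hu : u ≤ 3 * r) (h : s < s' ∨ s = s' ∧ u < u') :
    stamp r s u < stamp r s' u' := by
  unfold stamp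
  rcases h with h | ⟨rfl, h⟩
  · have := Nat.mul_le_mul_left (3 * r + 1) (Nat.succ_le_of_lt h)
    rw [Nat.mul_succ] at this
    omega
  · omega

theorem stamp_inj {r s u s' u' : ℕ} (hu : u ≤ 3 * r) (hu' : u' ≤ 3 * r) :
    stamp r s u = stamp r s' u' ↔ s = s' ∧ u = u' := by
  refine ⟨fun h => ?_, fun h => by rw [h.1, h.2]⟩
  by_contra hne
  rcases lt_trichotomy s s' with hs | hs | hs
  · exact absurd h (stamp_lt_stamp hu (Or.inl hs)).ne
  · rcases lt_trichotomy u u' with h1 | h1 | h1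
    · exact absurd h (stamp_lt_stamp hu (Or.inr ⟨hs, h1⟩)).ne
    · exact hne ⟨hs, h1⟩
    · exact absurd h (stamp_lt_stamp hu' (Or.inr ⟨hs.symm, h1⟩)).ne'
  · exact absurd h (stamp_lt_stamp hu' (Or.inl hs)).ne'

/-- The times of the clique vertex at position `p < m`. The word runs through the clique twice, in
increasing order of position: the slots `2 * p + 2` and `2 * m + 2 * p + 4` hold the vertex at
position `p`, the odd slots between them are the gaps of the two rounds. -/
def cliqueTimes (m r p : ℕ) : List ℕ :=
  [stamp r (2 * p + 2) 0, stamp r (2 * m + 2 * p + 4) 0]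

/-- The times of a vertex adjacent to the first and the last clique vertex: after the first one in
the first round, before the last one in the second round. Here `i < r` is an identifier. -/
def wrapTimes (m r i : ℕ) : List ℕ :=
  [stamp r 3 i, stamp r (4 * m + 1) (3 * r - i)]

/-- The times of a vertex adjacent to the clique vertices at positions less than `b`: around these
vertices in the second round and, in reverse order, before the first round. -/
def initialTimes (m r b i : ℕ) : List ℕ :=
  [stamp r 0 (r - i), stamp r (2 * m + 3) i, stamp r (2 * m + 2 * b + 3) (r + i)]

/-- The times of a vertex adjacent to the clique vertices at positions `p` with `a ≤ p < b`, for
`a ≠ 0`: around these vertices in the first round and, in reverse order, after the second round. -/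
def innerTimes (m r a b i : ℕ) : List ℕ :=
  [stamp r (2 * a + 1) (r + i), stamp r (2 * b + 1) (2 * r + i), stamp r (6 * m + 10 - b) (r - i)]

theorem alternating_of_lt₂₂ {x₁ y₁ x₂ y₂ : ℕ} (h₁ : x₁ < y₁) (h₂ : y₁ < x₂) (h₃ : x₂ < y₂) :
    Alternating [x₁, x₂] [y₁, y₂] := by
  refine Or.inl fun n => ?_
  simp only [timeCount, List.countP_cons, List.countP_nil, decide_eq_true_eq]
  split_ifs <;> omega

theorem alternating_of_lt₂₃ {x₁ y₁ x₂ y₂ x₃ : ℕ} (h₁ : x₁ < y₁) (h₂ : y₁ < x₂) (h₃ : x₂ < y₂)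
    (h₄ : y₂ < x₃) : Alternating [y₁, y₂] [x₁, x₂, x₃] := by
  refine Or.inr fun n => ?_
  simp only [timeCount, List.countP_cons, List.countP_nil, decide_eq_true_eq]
  split_ifs <;> omega

section Pairs

variable {m r : ℕ}

theorem alternating_clique_clique {p q : ℕ} (hp : p < m) (hq : q < m) (hpq : p ≠ q) :
    Alternating (cliqueTimes m r p) (cliqueTimes m r q) := by
  rcases lt_or_gt_of_ne hpq with h | h
  · exact alternating_of_lt₂₂ (stamp_lt_stamp (by omega) (by omega))
      (stamp_lt_stamp (by omega) (by omega)) (stamp_lt_stamp (by omega) (by omega))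
  · exact (alternating_of_lt₂₂ (stamp_lt_stamp (by omega) (by omega))
      (stamp_lt_stamp (by omega) (by omega)) (stamp_lt_stamp (by omega) (by omega))).symm

theorem alternating_clique_wrap {p i : ℕ} (hm : 3 ≤ m) (hp : p < m) (hi : i < r) :
    Alternating (cliqueTimes m r p) (wrapTimes m r i) ↔ p = 0 ∨ p + 1 = m := by
  refine ⟨fun h => ?_, fun h => ?_⟩
  · by_contra hne
    refine not_alternating_of_lt (s := stamp r (2 * p + 2) 0)
      (t := stamp r (2 * m + 2 * p + 4) 0) (by simp [cliqueTimes]) (by simp [cliqueTimes])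
      (stamp_lt_stamp (by omega) (by omega)) ?_ h
    simp only [wrapTimes, List.mem_cons, List.not_mem_nil, or_false, forall_eq_or_imp, forall_eq]
    exact ⟨Or.inl (stamp_lt_stamp (by omega) (by omega)),
      Or.inr (stamp_lt_stamp (by omega) (by omega))⟩
  · rcases h with rfl | h
    · exact alternating_of_lt₂₂ (stamp_lt_stamp (by omega) (by omega))
        (stamp_lt_stamp (by omega) (by omega)) (stamp_lt_stamp (by omega) (by omega))
    · exact (alternating_of_lt₂₂ (stamp_lt_stamp (by omega) (by omega))
        (stamp_lt_stamp (by omega) (by omega)) (stamp_lt_stamp (by omega) (by omega))).symm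

theorem alternating_clique_initial {p b i : ℕ} (hp : p < m) (hi : i < r) :
    Alternating (cliqueTimes m r p) (initialTimes m r b i) ↔ p < b := by
  refine ⟨fun h => ?_, fun h => ?_⟩
  · by_contra hne
    refine not_alternating_of_lt (s := stamp r (2 * m + 3) i)
      (t := stamp r (2 * m + 2 * b + 3) (r + i)) (by simp [initialTimes]) (by simp [initialTimes])
      (stamp_lt_stamp (by omega) (by omega)) ?_ h.symm
    simp only [cliqueTimes, List.mem_cons, List.not_mem_nil, or_false, forall_eq_or_imp, forall_eq]
    exact ⟨Or.inl (stamp_lt_stamp (by omega) (by omega)),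
      Or.inr (stamp_lt_stamp (by omega) (by omega))⟩
  · exact alternating_of_lt₂₃ (stamp_lt_stamp (by omega) (by omega))
      (stamp_lt_stamp (by omega) (by omega)) (stamp_lt_stamp (by omega) (by omega))
      (stamp_lt_stamp (by omega) (by omega))

theorem alternating_clique_inner {p a b i : ℕ} (hab : a ≤ b) (hb : b ≤ m)
    (hi : i < r) :
    Alternating (cliqueTimes m r p) (innerTimes m r a b i) ↔ a ≤ p ∧ p < b := by
  refine ⟨fun h => ?_, fun h => ?_⟩
  · by_contra hne
    refine not_alternating_of_lt (s := stamp r (2 * a + 1) (r + i))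
      (t := stamp r (2 * b + 1) (2 * r + i)) (by simp [innerTimes]) (by simp [innerTimes])
      (stamp_lt_stamp (by omega) (by omega)) ?_ h.symm
    simp only [cliqueTimes, List.mem_cons, List.not_mem_nil, or_false, forall_eq_or_imp, forall_eq]
    refine ⟨?_, Or.inr (stamp_lt_stamp (by omega) (by omega))⟩
    rcases lt_or_ge p a with h1 | h1
    · exact Or.inl (stamp_lt_stamp (by omega) (by omega))
    · exact Or.inr (stamp_lt_stamp (by omega) (by omega))
  · exact alternating_of_lt₂₃ (stamp_lt_stamp (by omega) (by omega))
      (stamp_lt_stamp (by omega) (by omega)) (stamp_lt_stamp (by omega) (by omega))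
      (stamp_lt_stamp (by omega) (by omega))

theorem not_alternating_wrap_wrap_of_lt {i j : ℕ} (hm : 3 ≤ m) (hij : i < j) (hj : j < r) :
    ¬ Alternating (wrapTimes m r j) (wrapTimes m r i) := by
  refine not_alternating_of_lt (s := stamp r 3 j) (t := stamp r (4 * m + 1) (3 * r - j))
    (by simp [wrapTimes]) (by simp [wrapTimes]) (stamp_lt_stamp (by omega) (by omega)) ?_
  simp only [wrapTimes, List.mem_cons, List.not_mem_nil, or_false, forall_eq_or_imp, forall_eq]
  exact ⟨Or.inl (stamp_lt_stamp (by omega) (by omega)),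
    Or.inr (stamp_lt_stamp (by omega) (by omega))⟩

theorem not_alternating_initial_wrap {b i j : ℕ} (hm : 3 ≤ m) (hb : b ≤ 2) (hi : i < r)
    (hj : j < r) : ¬ Alternating (initialTimes m r b i) (wrapTimes m r j) := by
  refine not_alternating_of_lt (s := stamp r (2 * m + 3) i)
    (t := stamp r (2 * m + 2 * b + 3) (r + i)) (by simp [initialTimes]) (by simp [initialTimes])
    (stamp_lt_stamp (by omega) (by omega)) ?_
  simp only [wrapTimes, List.mem_cons, List.not_mem_nil, or_false, forall_eq_or_imp, forall_eq]
  exact ⟨Or.inl (stamp_lt_stamp (by omega) (by omega)),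
    Or.inr (stamp_lt_stamp (by omega) (by omega))⟩

theorem not_alternating_inner_wrap {a b i j : ℕ} (hm : 3 ≤ m) (ha : a ≠ 0) (hab : a ≤ b)
    (hb : b ≤ m) (hi : i < r) (hj : j < r) :
    ¬ Alternating (innerTimes m r a b i) (wrapTimes m r j) := by
  refine not_alternating_of_lt (s := stamp r (2 * a + 1) (r + i))
    (t := stamp r (2 * b + 1) (2 * r + i)) (by simp [innerTimes]) (by simp [innerTimes])
    (stamp_lt_stamp (by omega) (by omega)) ?_
  simp only [wrapTimes, List.mem_cons, List.not_mem_nil, or_false, forall_eq_or_imp, forall_eq]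
  exact ⟨Or.inl (stamp_lt_stamp (by omega) (by omega)),
    Or.inr (stamp_lt_stamp (by omega) (by omega))⟩

theorem not_alternating_initial_initial_of_lt {b b' i j : ℕ} (hij : i < j) (hj : j < r) :
    ¬ Alternating (initialTimes m r b i) (initialTimes m r b' j) := by
  refine not_alternating_of_lt (s := stamp r 0 (r - i)) (t := stamp r (2 * m + 3) i)
    (by simp [initialTimes]) (by simp [initialTimes]) (stamp_lt_stamp (by omega) (by omega)) ?_
  simp only [initialTimes, List.mem_cons, List.not_mem_nil, or_false, forall_eq_or_imp, forall_eq]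
  exact ⟨Or.inl (stamp_lt_stamp (by omega) (by omega)),
    Or.inr (stamp_lt_stamp (by omega) (by omega)), Or.inr (stamp_lt_stamp (by omega) (by omega))⟩

theorem not_alternating_inner_initial {a b b' i j : ℕ} (hab : a ≤ b) (hb : b ≤ m) (hi : i < r)
    (hj : j < r) : ¬ Alternating (innerTimes m r a b i) (initialTimes m r b' j) := by
  refine not_alternating_of_lt (s := stamp r (2 * a + 1) (r + i))
    (t := stamp r (2 * b + 1) (2 * r + i)) (by simp [innerTimes]) (by simp [innerTimes])
    (stamp_lt_stamp (by omega) (by omega)) ?_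
  simp only [initialTimes, List.mem_cons, List.not_mem_nil, or_false, forall_eq_or_imp, forall_eq]
  exact ⟨Or.inl (stamp_lt_stamp (by omega) (by omega)),
    Or.inr (stamp_lt_stamp (by omega) (by omega)), Or.inr (stamp_lt_stamp (by omega) (by omega))⟩

/-- Of two inner vertices, the one whose second occurrence comes last has its third occurrence
first. -/
theorem not_alternating_inner_inner_of_lt {a b a' b' i j : ℕ} (hab : a ≤ b) (hb : b ≤ m)
    (h : b < b' ∨ b = b' ∧ i < j) (hb' : b' ≤ m) (hi : i < r) (hj : j < r) :
    ¬ Alternating (innerTimes m r a' b' j) (innerTimes m r a b i) := by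
  refine not_alternating_of_lt (s := stamp r (2 * b' + 1) (2 * r + j))
    (t := stamp r (6 * m + 10 - b') (r - j)) (by simp [innerTimes]) (by simp [innerTimes])
    (stamp_lt_stamp (by omega) (by omega)) ?_
  simp only [innerTimes, List.mem_cons, List.not_mem_nil, or_false, forall_eq_or_imp, forall_eq]
  exact ⟨Or.inl (stamp_lt_stamp (by omega) (by omega)),
    Or.inl (stamp_lt_stamp (by omega) (by omega)), Or.inr (stamp_lt_stamp (by omega) (by omega))⟩

end Pairs

/-- A split graph is word-representable if its clique can be arranged on a cycle so that every
vertex of the independent set sees at most two clique vertices, consecutive on the cycle. Here `C`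
singles out the vertices that see the first and the last position; the others see the positions
from `a e` to `b e - 1`. -/
theorem wordRepresentable_of_position {V : Type*} [Fintype V] [DecidableEq V] {G : SimpleGraph V}
    {E K : Finset V} (hS : IsSplitPartition G E K) {m : ℕ} {pos : V → ℕ}
    (hpos : ∀ x ∈ K, pos x < m) (hinj : Set.InjOn pos K) (C : V → Prop) (a b : V → ℕ)
    (hC : ∀ e ∈ E, C e → 3 ≤ m ∧ ∀ x ∈ K, G.Adj x e ↔ pos x = 0 ∨ pos x + 1 = m)
    (hI : ∀ e ∈ E, ¬ C e → a e ≤ b e ∧ b e ≤ m ∧ b e ≤ a e + 2 ∧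
      ∀ x ∈ K, G.Adj x e ↔ a e ≤ pos x ∧ pos x < b e) : WordRepresentable G := by
  classical
  obtain ⟨r, i, hi, hir⟩ : ∃ (r : ℕ) (i : V → ℕ), Function.Injective i ∧ ∀ v, i v < r :=
    ⟨Fintype.card V, fun v => Fintype.equivFin V v,
      fun x y h => (Fintype.equivFin V).injective (Fin.ext h), fun v => (Fintype.equivFin V v).2⟩
  have hEK : ∀ v, v ∉ K → v ∈ E := fun v hv => (hS.cover v).resolve_right hv
  let T : V → List ℕ := fun v =>
    if v ∈ K then cliqueTimes m r (pos v) else if C v then wrapTimes m r (i v)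
    else if a v = 0 then initialTimes m r (b v) (i v) else innerTimes m r (a v) (b v) (i v)
  have hT : ∀ v, (v ∈ K ∧ T v = cliqueTimes m r (pos v)) ∨
      (v ∈ E ∧ C v ∧ T v = wrapTimes m r (i v)) ∨
      (v ∈ E ∧ ¬ C v ∧ a v = 0 ∧ T v = initialTimes m r (b v) (i v)) ∨
      (v ∈ E ∧ ¬ C v ∧ a v ≠ 0 ∧ T v = innerTimes m r (a v) (b v) (i v)) := by
    intro v
    by_cases h1 : v ∈ K
    · simp [T, h1]
    · have := hEK v h1
      by_cases h2 : C v
      · simp [T, h1, h2, this]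
      · by_cases h3 : a v = 0 <;> simp [T, h1, h2, h3, this]
  have hEE : ∀ x ∈ E, ∀ y ∈ E, x ≠ y → ¬ G.Adj x y := fun x hx y hy hxy => hS.indep hx hy hxy
  refine wordRepresentable_of_times G T (fun v => ?_) (fun v => ?_) (fun x y t hx hy => ?_)
    (fun x y hxy => ?_)
  · rcases hT v with ⟨-, h⟩ | ⟨-, -, h⟩ | ⟨-, -, -, h⟩ | ⟨-, -, -, h⟩ <;> rw [h] <;>
      simp [cliqueTimes, wrapTimes, initialTimes, innerTimes]
  · have hr := hir v
    rcases hT v with ⟨hK, h⟩ | ⟨hE, hCv, h⟩ | ⟨hE, hCv, ha, h⟩ | ⟨hE, hCv, ha, h⟩ <;> rw [h]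
    · simp only [cliqueTimes, List.nodup_cons, List.mem_cons, List.not_mem_nil, or_false,
        not_false_eq_true, List.nodup_nil, and_true]
      exact (stamp_lt_stamp (by omega) (by omega)).ne
    · have := (hC v hE hCv).1
      simp only [wrapTimes, List.nodup_cons, List.mem_cons, List.not_mem_nil, or_false,
        not_false_eq_true, List.nodup_nil, and_true]
      exact (stamp_lt_stamp (by omega) (by omega)).ne
    · simp only [initialTimes, List.nodup_cons, List.mem_cons, List.not_mem_nil, or_false,
        not_false_eq_true, List.nodup_nil, and_true, not_or]
      exact ⟨⟨(stamp_lt_stamp (by omega) (by omega)).ne,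
        (stamp_lt_stamp (by omega) (by omega)).ne⟩, (stamp_lt_stamp (by omega) (by omega)).ne⟩
    · have := hI v hE hCv
      simp only [innerTimes, List.nodup_cons, List.mem_cons, List.not_mem_nil, or_false,
        not_false_eq_true, List.nodup_nil, and_true, not_or]
      exact ⟨⟨(stamp_lt_stamp (by omega) (by omega)).ne,
        (stamp_lt_stamp (by omega) (by omega)).ne⟩, (stamp_lt_stamp (by omega) (by omega)).ne⟩
  · -- The slots and offsets used by different kinds of vertices are disjoint, and within a kind
    -- they determine the position or the identifier.
    have hrx := hir x
    have hry := hir y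
    have hstamp : ∃ s u, t = stamp r s u ∧ u ≤ 3 * r ∧
        ∀ s' u', u' ≤ 3 * r → (t = stamp r s' u' ↔ s = s' ∧ u = u') := by
      rcases hT x with ⟨hK, h⟩ | ⟨hE, hCv, h⟩ | ⟨hE, hCv, ha, h⟩ | ⟨hE, hCv, ha, h⟩ <;>
        rw [h] at hx <;>
        simp only [cliqueTimes, wrapTimes, initialTimes, innerTimes, List.mem_cons,
          List.not_mem_nil, or_false] at hx
      · rcases hx with rfl | rfl <;>
          exact ⟨_, _, rfl, by omega, fun s' u' hu => stamp_inj (by omega) hu⟩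
      · rcases hx with rfl | rfl <;>
          exact ⟨_, _, rfl, by omega, fun s' u' hu => stamp_inj (by omega) hu⟩
      · rcases hx with rfl | rfl | rfl <;>
          exact ⟨_, _, rfl, by omega, fun s' u' hu => stamp_inj (by omega) hu⟩
      · rcases hx with rfl | rfl | rfl <;>
          exact ⟨_, _, rfl, by omega, fun s' u' hu => stamp_inj (by omega) hu⟩
    obtain ⟨s, u, -, -, hs⟩ := hstamp
    have hk : ∀ p, t ∈ cliqueTimes m r p ↔ u = 0 ∧ (s = 2 * p + 2 ∨ s = 2 * m + 2 * p + 4) := by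
      intro p
      simp only [cliqueTimes, List.mem_cons, List.not_mem_nil, or_false]
      rw [hs _ _ (by omega), hs _ _ (by omega)]
      omega
    have hw : ∀ j, j < r → (t ∈ wrapTimes m r j ↔
        s = 3 ∧ u = j ∨ s = 4 * m + 1 ∧ u = 3 * r - j) := by
      intro j hj
      simp only [wrapTimes, List.mem_cons, List.not_mem_nil, or_false]
      rw [hs _ _ (by omega), hs _ _ (by omega)]
    have hl : ∀ c j, j < r → (t ∈ initialTimes m r c j ↔
        s = 0 ∧ u = r - j ∨ s = 2 * m + 3 ∧ u = j ∨ s = 2 * m + 2 * c + 3 ∧ u = r + j) := by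
      intro c j hj
      simp only [initialTimes, List.mem_cons, List.not_mem_nil, or_false]
      rw [hs _ _ (by omega), hs _ _ (by omega), hs _ _ (by omega)]
    have hn : ∀ d c j, j < r → (t ∈ innerTimes m r d c j ↔
        s = 2 * d + 1 ∧ u = r + j ∨ s = 2 * c + 1 ∧ u = 2 * r + j ∨
          s = 6 * m + 10 - c ∧ u = r - j) := by
      intro d c j hj
      simp only [innerTimes, List.mem_cons, List.not_mem_nil, or_false]
      rw [hs _ _ (by omega), hs _ _ (by omega), hs _ _ (by omega)]
    have hTE : ∀ v ∈ E, (C v → 3 ≤ m) ∧ (¬ C v → a v ≤ b v ∧ b v ≤ m) := fun v hv =>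
      ⟨fun hCv => (hC v hv hCv).1, fun hCv => ⟨(hI v hv hCv).1, (hI v hv hCv).2.1⟩⟩
    have hxy : pos x = pos y ∧ x ∈ K ∧ y ∈ K ∨ i x = i y := by
      rcases hT x with ⟨hxK, h⟩ | ⟨hxE, hCx, h⟩ | ⟨hxE, hCx, ha, h⟩ | ⟨hxE, hCx, ha, h⟩ <;>
        rcases hT y with ⟨hyK, h'⟩ | ⟨hyE, hCy, h'⟩ | ⟨hyE, hCy, ha', h'⟩ | ⟨hyE, hCy, ha', h'⟩ <;>
        rw [h] at hx <;> rw [h'] at hy <;>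
        simp only [hk, hw _ hrx, hw _ hry, hl _ _ hrx, hl _ _ hry, hn _ _ _ hrx,
          hn _ _ _ hry] at hx hy
      · have := hpos x hxK
        have := hpos y hyK
        exact Or.inl ⟨by omega, hxK, hyK⟩
      all_goals
        right
        first
          | (have hf := (hTE x hxE).1 hCx)
          | (have hf := (hTE x hxE).2 hCx)
          | skip
        first
          | (have hf' := (hTE y hyE).1 hCy)
          | (have hf' := (hTE y hyE).2 hCy)
          | skip
        omega
    rcases hxy with h | h
    · exact hinj h.2.1 h.2.2 h.1
    · exact hi h
  · rcases hT x with ⟨hx, h⟩ | ⟨hx, hCx, h⟩ | ⟨hx, hCx, ha, h⟩ | ⟨hx, hCx, ha, h⟩ <;>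
      rcases hT y with ⟨hy, h'⟩ | ⟨hy, hCy, h'⟩ | ⟨hy, hCy, ha', h'⟩ | ⟨hy, hCy, ha', h'⟩ <;>
      rw [h, h']
    · exact iff_of_true (hS.clique.1 hx hy hxy)
        (alternating_clique_clique (hpos x hx) (hpos y hy) (hinj.ne hx hy hxy))
    · obtain ⟨hm, hadj⟩ := hC y hy hCy
      rw [hadj x hx, alternating_clique_wrap hm (hpos x hx) (hir y)]
    · obtain ⟨hab, hbm, -, hadj⟩ := hI y hy hCy
      rw [hadj x hx, alternating_clique_initial (hpos x hx) (hir y)]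
      omega
    · obtain ⟨hab, hbm, -, hadj⟩ := hI y hy hCy
      rw [hadj x hx, alternating_clique_inner hab hbm (hir y)]
    · obtain ⟨hm, hadj⟩ := hC x hx hCx
      rw [G.adj_comm, hadj y hy, alternating_comm, alternating_clique_wrap hm (hpos y hy) (hir x)]
    · refine iff_of_false (hEE x hx y hy hxy) ?_
      obtain ⟨hm, -⟩ := hC x hx hCx
      rcases lt_or_gt_of_ne (hi.ne hxy) with hlt | hlt
      · exact fun hc => not_alternating_wrap_wrap_of_lt hm hlt (hir y) hc.symm
      · exact not_alternating_wrap_wrap_of_lt hm hlt (hir x)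
    · refine iff_of_false (hEE x hx y hy hxy) fun hc => ?_
      have := hI y hy hCy
      exact not_alternating_initial_wrap (hC x hx hCx).1 (by omega) (hir y) (hir x) hc.symm
    · refine iff_of_false (hEE x hx y hy hxy) fun hc => ?_
      obtain ⟨hab, hbm, -, -⟩ := hI y hy hCy
      exact not_alternating_inner_wrap (hC x hx hCx).1 ha' hab hbm (hir y) (hir x) hc.symm
    · obtain ⟨hab, hbm, -, hadj⟩ := hI x hx hCx
      rw [G.adj_comm, hadj y hy, alternating_comm, alternating_clique_initial (hpos y hy) (hir x)]
      omega
    · refine iff_of_false (hEE x hx y hy hxy) ?_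
      have := hI x hx hCx
      exact not_alternating_initial_wrap (hC y hy hCy).1 (by omega) (hir x) (hir y)
    · refine iff_of_false (hEE x hx y hy hxy) ?_
      rcases lt_or_gt_of_ne (hi.ne hxy) with hlt | hlt
      · exact not_alternating_initial_initial_of_lt hlt (hir y)
      · exact fun hc => not_alternating_initial_initial_of_lt hlt (hir x) hc.symm
    · refine iff_of_false (hEE x hx y hy hxy) fun hc => ?_
      obtain ⟨hab, hbm, -, -⟩ := hI y hy hCy
      exact not_alternating_inner_initial hab hbm (hir y) (hir x) hc.symm
    · obtain ⟨hab, hbm, -, hadj⟩ := hI x hx hCx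
      rw [G.adj_comm, hadj y hy, alternating_comm, alternating_clique_inner hab hbm (hir x)]
    · refine iff_of_false (hEE x hx y hy hxy) ?_
      obtain ⟨hab, hbm, -, -⟩ := hI x hx hCx
      exact not_alternating_inner_wrap (hC y hy hCy).1 ha hab hbm (hir x) (hir y)
    · refine iff_of_false (hEE x hx y hy hxy) ?_
      obtain ⟨hab, hbm, -, -⟩ := hI x hx hCx
      exact not_alternating_inner_initial hab hbm (hir x) (hir y)
    · refine iff_of_false (hEE x hx y hy hxy) ?_
      obtain ⟨hab, hbm, -, -⟩ := hI x hx hCx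
      obtain ⟨hab', hbm', -, -⟩ := hI y hy hCy
      by_cases hlt : b x < b y ∨ b x = b y ∧ i x < i y
      · exact fun hc => not_alternating_inner_inner_of_lt hab hbm hlt hbm' (hir x) (hir y) hc.symm
      · have := hi.ne hxy
        exact not_alternating_inner_inner_of_lt hab' hbm' (by omega) hbm (hir y) (hir x)

/-! ### The graph of common neighbours -/

/-- The graph on the vertices of `G` in which `x` and `y` in `K` are joined when they have a common
neighbour in `E`. -/
def commonNeighborGraph {V : Type*} (G : SimpleGraph V) (E K : Finset V) : SimpleGraph V where
  Adj x y := x ≠ y ∧ x ∈ K ∧ y ∈ K ∧ ∃ e ∈ E, G.Adj e x ∧ G.Adj e y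
  symm := ⟨fun _ _ ⟨hne, hx, hy, e, he, h1, h2⟩ => ⟨hne.symm, hy, hx, e, he, h2, h1⟩⟩
  loopless := ⟨fun _ h => h.1 rfl⟩

section Split

variable {V : Type*} {G : SimpleGraph V} {E K : Finset V}

theorem eq_or_eq_of_adj_of_degree_le_two [Fintype V] [DecidableRel G.Adj] {e x y z : V}
    (he : G.degree e ≤ 2) (hx : G.Adj e x) (hy : G.Adj e y) (hxy : x ≠ y) (hz : G.Adj e z) :
    z = x ∨ z = y := by
  classical
  by_contra! h
  have hcard : ({x, y, z} : Finset V).card = 3 := Finset.card_eq_three.2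
    ⟨x, y, z, hxy, h.1.symm, h.2.symm, rfl⟩
  have hsub : ({x, y, z} : Finset V) ⊆ G.neighborFinset e := by
    intro v hv
    simp only [Finset.mem_insert, Finset.mem_singleton] at hv
    rcases hv with rfl | rfl | rfl <;> simpa
  have := Finset.card_le_card hsub
  rw [G.card_neighborFinset_eq_degree] at this
  omega

/-- Three neighbours of a vertex in the common neighbour graph give a copy of `graphT2`. -/
theorem graphT2_isIndContained (hS : IsSplitPartition G E K)
    (htwo : ∀ e ∈ E, ∀ x y z, G.Adj e x → G.Adj e y → x ≠ y → G.Adj e z → z = x ∨ z = y)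
    {x a b c : V} (ha : (commonNeighborGraph G E K).Adj x a)
    (hb : (commonNeighborGraph G E K).Adj x b) (hc : (commonNeighborGraph G E K).Adj x c)
    (hab : a ≠ b) (hac : a ≠ c) (hbc : b ≠ c) : graphT2.IsIndContained G := by
  obtain ⟨hxa, hx, ha, e, he, hex, hea⟩ := ha
  obtain ⟨hxb, -, hb, f, hf, hfx, hfb⟩ := hb
  obtain ⟨hxc, -, hc, g, hg, hgx, hgc⟩ := hc
  have hK : ∀ u ∈ K, ∀ v ∈ K, u ≠ v → G.Adj u v := fun u hu v hv huv => hS.clique.1 hu hv huv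
  have hE : ∀ u ∈ E, ∀ v ∈ E, ¬ G.Adj u v := fun u hu v hv huv => hS.indep hu hv huv.ne huv
  have hEK : ∀ u ∈ E, ∀ v ∈ K, u ≠ v := fun u hu v hv huv =>
    Finset.disjoint_left.1 hS.disjoint hu (huv ▸ hv)
  have heb : ¬ G.Adj e b := fun h => by
    rcases htwo e he _ _ _ hex hea hxa h with h | h
    exacts [hxb h.symm, hab h.symm]
  have hec : ¬ G.Adj e c := fun h => by
    rcases htwo e he _ _ _ hex hea hxa h with h | h
    exacts [hxc h.symm, hac h.symm]
  have hfa : ¬ G.Adj f a := fun h => by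
    rcases htwo f hf _ _ _ hfx hfb hxb h with h | h
    exacts [hxa h.symm, hab h]
  have hfc : ¬ G.Adj f c := fun h => by
    rcases htwo f hf _ _ _ hfx hfb hxb h with h | h
    exacts [hxc h.symm, hbc h.symm]
  have hga : ¬ G.Adj g a := fun h => by
    rcases htwo g hg _ _ _ hgx hgc hxc h with h | h
    exacts [hxa h.symm, hac h]
  have hgb : ¬ G.Adj g b := fun h => by
    rcases htwo g hg _ _ _ hgx hgc hxc h with h | h
    exacts [hxb h.symm, hbc h]
  have hef : e ≠ f := fun h => heb (h ▸ hfb)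
  have heg : e ≠ g := fun h => hec (h ▸ hgc)
  have hfg : f ≠ g := fun h => hfc (h ▸ hgc)
  let φ : Fin 7 → V := ![c, x, a, b, e, f, g]
  have hinj : Function.Injective φ := by
    have := hEK e he
    have := hEK f hf
    have := hEK g hg
    intro i j hij
    fin_cases i <;> fin_cases j <;> simp [φ] at hij ⊢ <;> grind
  refine ⟨⟨⟨φ, hinj⟩, fun {i j} => ?_⟩⟩
  change G.Adj (φ i) (φ j) ↔ graphT2.Adj i j
  have hadj : ∀ i j : Fin 7, i < j → (G.Adj (φ i) (φ j) ↔ graphT2.Adj i j) := by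
    intro i j hij
    fin_cases i <;> fin_cases j <;> simp [φ, graphT2] at hij ⊢ <;>
      first
        | exact hK _ ‹_› _ ‹_› (by first | assumption | exact Ne.symm ‹_›)
        | exact hE _ ‹_› _ ‹_›
        | assumption
        | exact SimpleGraph.Adj.symm ‹_›
        | exact fun h => absurd h.symm ‹_›
  rcases lt_trichotomy i j with h | rfl | h
  · exact hadj i j h
  · simp
  · rw [G.adj_comm, graphT2.adj_comm, hadj j i h]

/-- A cycle in the common neighbour graph and a vertex of the clique off the cycle give a copy of
`graphA`. -/
theorem graphA_isIndContained (hS : IsSplitPartition G E K)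
    (htwo : ∀ e ∈ E, ∀ x y z, G.Adj e x → G.Adj e y → x ≠ y → G.Adj e z → z = x ∨ z = y)
    {l : List V} (hl : IsCycleList (commonNeighborGraph G E K) l) {z : V} (hz : z ∈ K)
    (hzl : z ∉ l) : (graphA (l.length + 1)).IsIndContained G := by
  have h3 := hl.three_le
  set r := l.length with hr
  have hK : ∀ u ∈ K, ∀ v ∈ K, u ≠ v → G.Adj u v := fun u hu v hv huv => hS.clique.1 hu hv huv
  have hE : ∀ u ∈ E, ∀ v ∈ E, ¬ G.Adj u v := fun u hu v hv huv => hS.indep hu hv huv.ne huv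
  have hEK : ∀ u ∈ E, ∀ v ∈ K, u ≠ v := fun u hu v hv huv =>
    Finset.disjoint_left.1 hS.disjoint hu (huv ▸ hv)
  let v : Fin r → V := fun i => l[i]
  have hvinj : Function.Injective v := fun i j hij => Fin.ext (hl.nodup.getElem_inj_iff.1 hij)
  let next : Fin r → Fin r := fun i => ⟨((i : ℕ) + 1) % r, Nat.mod_lt _ (by omega)⟩
  have hnext : ∀ i, (next i : ℕ) = if (i : ℕ) + 1 = r then 0 else (i : ℕ) + 1 := fun i =>
    Nat.succ_mod_eq_ite i.2
  have hvadj : ∀ i, (commonNeighborGraph G E K).Adj (v i) (v (next i)) := by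
    intro i
    have hn := hnext i
    have hi := i.2
    split_ifs at hn with h
    · have : next i = ⟨0, by omega⟩ := Fin.ext hn
      have hi' : i = ⟨l.length - 1, by omega⟩ := Fin.ext (by simp; omega)
      have h1 : v i = l[l.length - 1] := congrArg v hi'
      have h2 : v (next i) = l[0] := congrArg v this
      rw [h1, h2]
      exact hl.adj_last
    · have : next i = ⟨i + 1, by omega⟩ := Fin.ext hn
      rw [this]
      exact hl.adj i (by omega)
  choose hvne hvK _ e heE hev hevn using hvadj
  have hadj : ∀ i j, G.Adj (e j) (v i) ↔ i = j ∨ i = next j := by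
    intro i j
    constructor
    · intro h
      rcases htwo _ (heE j) _ _ _ (hev j) (hevn j) (hvne j) h with h | h
      exacts [Or.inl (hvinj h), Or.inr (hvinj h)]
    · rintro (rfl | rfl)
      exacts [hev _, hevn _]
  have hvz : ∀ i, v i ≠ z := fun i h => hzl (h ▸ List.getElem_mem _)
  have hez : ∀ i, ¬ G.Adj (e i) z := fun i h => by
    rcases htwo _ (heE i) _ _ _ (hev i) (hevn i) (hvne i) h with h | h
    exacts [hvz _ h.symm, hvz _ h.symm]
  -- As the cycle has at least three vertices, a vertex of `E` determines its edge of the cycle.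
  have heinj : Function.Injective e := by
    intro i j hij
    have h1 := (hadj i j).1 (hij ▸ hev i)
    have h2 := (hadj j i).1 (hij ▸ hev j)
    have hi := hnext i
    have hj := hnext j
    have hi2 := i.2
    have hj2 := j.2
    simp only [Fin.ext_iff] at h1 h2 ⊢
    split_ifs at hi hj <;> omega
  let φ : Option (Fin r ⊕ Fin r) → V := fun o => o.elim z (Sum.elim v e)
  have hφ : Function.Injective φ := by
    rintro (_ | i | i) (_ | j | j) h
    · rfl
    · exact absurd h.symm (hvz j)
    · exact absurd h.symm (hEK _ (heE j) _ hz)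
    · exact absurd h (hvz i)
    · exact congrArg (fun i => some (Sum.inl i)) (hvinj h)
    · exact absurd h.symm (hEK _ (heE j) _ (hvK i))
    · exact absurd h (hEK _ (heE i) _ hz)
    · exact absurd h (hEK _ (heE i) _ (hvK j))
    · exact congrArg (fun i => some (Sum.inr i)) (heinj h)
  refine ⟨⟨⟨φ, hφ⟩, ?_⟩⟩
  rintro (_ | i | i) (_ | j | j)
  · exact iff_of_false (G.loopless.irrefl z) fun h => h
  · exact iff_of_true (hK _ hz _ (hvK j) (hvz j).symm) trivial
  · exact iff_of_false (fun h => hez j h.symm) fun h => h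
  · exact iff_of_true (hK _ (hvK i) _ hz (hvz i)) trivial
  · exact ⟨fun h => fun hij => h.ne (congrArg v hij),
      fun h => hK _ (hvK i) _ (hvK j) (hvinj.ne h)⟩
  · exact (G.adj_comm _ _).trans ((hadj i j).trans (or_congr_right Fin.ext_iff))
  · exact iff_of_false (hez i) fun h => h
  · exact (hadj j i).trans (or_congr_right Fin.ext_iff)
  · exact iff_of_false (hE _ (heE i) _ (heE j)) fun h => h

end Split

theorem theorem6 {V : Type*} [Fintype V] [DecidableEq V] (G : SimpleGraph V)
    [DecidableRel G.Adj] (E K : Finset V) (hS : IsSplitPartition G E K) (hm : 1 ≤ K.card)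
    (hdeg : ∀ v ∈ E, G.degree v ≤ 2) :
    WordRepresentable G ↔
      ¬ graphT2.IsIndContained G ∧ ∀ l : ℕ, 4 ≤ l → ¬ (graphA l).IsIndContained G := by
  classical
  constructor
  · intro hG
    refine ⟨fun h => ?_, fun l hl h => ?_⟩
    · obtain ⟨c, hc⟩ := hG.exists_countRepresents h
      exact not_countRepresents_graphT2 c hc
    · obtain ⟨c, hc⟩ := hG.exists_countRepresents h
      exact not_countRepresents_graphA hl c hc
  rintro ⟨hT2, hA⟩
  have htwo : ∀ e ∈ E, ∀ x y z, G.Adj e x → G.Adj e y → x ≠ y → G.Adj e z → z = x ∨ z = y :=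
    fun e he x y z hx hy hxy hz => eq_or_eq_of_adj_of_degree_le_two (hdeg e he) hx hy hxy hz
  obtain ⟨pos, hinj, hlt, hpos⟩ := exists_cyclic_position (H := commonNeighborGraph G E K)
    (fun x a b c ha hb hc => by
      by_contra! h
      exact hT2 (graphT2_isIndContained hS htwo ha hb hc h.1 h.2.1 h.2.2)) K
    (fun x y hxy => hxy.2.1)
    (fun l hl x hx => by
      by_contra hxl
      exact hA (l.length + 1) (by have := hl.three_le; omega)
        (graphA_isIndContained hS htwo hl hx hxl))
  have hadjK : ∀ e ∈ E, ∀ x, G.Adj e x → x ∈ K := fun e he x hx =>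
    (hS.cover x).resolve_left fun hxE => hS.indep he hxE hx.ne hx
  have harc : ∀ e ∈ E, (3 ≤ K.card ∧ ∀ x ∈ K, G.Adj x e ↔ pos x = 0 ∨ pos x + 1 = K.card) ∨
      ∃ a b, a ≤ b ∧ b ≤ K.card ∧ b ≤ a + 2 ∧ ∀ x ∈ K, G.Adj x e ↔ a ≤ pos x ∧ pos x < b := by
    intro e he
    by_cases h0 : ∃ p, G.Adj e p
    · obtain ⟨p, hp⟩ := h0
      have hpK := hadjK e he p hp
      have hpm := hlt p hpK
      by_cases h1 : ∃ q, q ≠ p ∧ G.Adj e q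
      · obtain ⟨q, hqp, hq⟩ := h1
        have hqK := hadjK e he q hq
        have hqm := hlt q hqK
        have hiff : ∀ x ∈ K, G.Adj x e ↔ pos x = pos p ∨ pos x = pos q := by
          intro x hx
          rw [G.adj_comm]
          constructor
          · intro h
            rcases htwo e he _ _ _ hp hq hqp.symm h with rfl | rfl
            exacts [Or.inl rfl, Or.inr rfl]
          · rintro (h | h)
            · rwa [hinj hx hpK h]
            · rwa [hinj hx hqK h]
        have hcons := hpos p q ⟨hqp.symm, hpK, hqK, e, he, hp, hq⟩
        by_cases hnext : pos p = pos q + 1 ∨ pos q = pos p + 1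
        · refine Or.inr ⟨min (pos p) (pos q), min (pos p) (pos q) + 2, by omega, by omega,
            le_rfl, fun x hx => ?_⟩
          rw [hiff x hx]
          omega
        · have hne : pos p ≠ pos q := fun h => hqp (hinj hqK hpK h.symm)
          refine Or.inl ⟨by omega, fun x hx => ?_⟩
          rw [hiff x hx]
          omega
      · refine Or.inr ⟨pos p, pos p + 1, by omega, by omega, by omega, fun x hx => ?_⟩
        rw [G.adj_comm]
        constructor
        · intro h
          by_cases hxp : x = p
          · subst hxp; omega
          · exact absurd ⟨x, hxp, h⟩ h1
        · intro h
          rwa [hinj hx hpK (by omega)]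
    · refine Or.inr ⟨0, 0, le_rfl, by omega, by omega, fun x _ => ?_⟩
      exact iff_of_false (fun h => h0 ⟨x, h.symm⟩) (by omega)
  let C : V → Prop := fun e => 3 ≤ K.card ∧ ∀ x ∈ K, G.Adj x e ↔ pos x = 0 ∨ pos x + 1 = K.card
  have hI : ∀ e, ∃ ab : ℕ × ℕ, e ∈ E → ¬ C e → ab.1 ≤ ab.2 ∧ ab.2 ≤ K.card ∧ ab.2 ≤ ab.1 + 2 ∧
      ∀ x ∈ K, G.Adj x e ↔ ab.1 ≤ pos x ∧ pos x < ab.2 := by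
    intro e
    by_cases h : e ∈ E ∧ ¬ C e
    · obtain ⟨a, b, hab⟩ := (harc e h.1).resolve_left h.2
      exact ⟨(a, b), fun _ _ => hab⟩
    · exact ⟨(0, 0), fun h1 h2 => absurd ⟨h1, h2⟩ h⟩
  choose ab hab using hI
  exact wordRepresentable_of_position hS hlt hinj C (fun e => (ab e).1) (fun e => (ab e).2)
    (fun e _ h => h) hab
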